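/- For integers $m,n\ge 3$ and $l\ge -1$, let the dumbbell graph $D(m,l,n)$ be the finite simple graph on $m+l+n$ vertices consisting of two cycles $C_m$ and $C_n$ linked by a path $P_l$ on $l$ vertices: for $l\ge 2$ one leaf of $P_l$ is joined by an edge to one vertex of $C_m$ and the other leaf to one vertex of $C_n$; for $l=1$ the single vertex of $P_1$ is joined to one vertex of $C_m$ and to one vertex of $C_n$; for $l=0$ one vertex of $C_m$ is joined by an edge to one vertex of $C_n$; for $l=-1$ the two cycles share exactly one vertex. For a finite simple graph $G=(V,E)$ let $$X_G=\sum_k\ \prod_{v\in V}x_{k(v)}\in\mathbb{Q}[[x_1,x_2,\ldots]]$$ be its chromatic symmetric function, the sum being over all proper colourings $k$ of $G$ by positive integers. For a partition $\lambda=(\lambda_1,\ldots,\lambda_r)$ let $e_\lambda=e_{\lambda_1}\cdots e_{\lambda_r}$, where $e_i=\sum_{j_1<\cdots<j_i}x_{j_1}\cdots x_{j_i}$. **Theorem.** For all integers $m\ge 3$ and $l\ge -1$, the symmetric function $X_{D(m,l,3)}$ is $e$-positive, i.e. it is a finite linear combination of the basis $\{e_\lambda\}$ of the algebra of symmetric functions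 with nonnegative coefficients. -/

import Mathlib

noncomputable section

namespace Dumbbell

/-- The formal power series `∑ i, x ^ (a i)` in countably many variables over `ℚ`: the coefficient
at a monomial is the number of indices `i` that contribute that monomial. This is meaningful when
each monomial arises from finitely many indices; for the two families used below this is proved in
`finite_elemFiber` and `finite_colouringFiber`. -/
def monomialSum {ι : Type*} (a : ι → (ℕ →₀ ℕ)) : MvPowerSeries ℕ ℚ :=
  fun d => (Nat.card {i : ι // a i = d} : ℚ)

/-- The monomial `∏ j ∈ s, x_j`, as an exponent vector. -/
def setExponent (s : Finset ℕ) : ℕ →₀ ℕ := ∑ j ∈ s, Finsupp.single j 1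

/-- The elementary symmetric function `e_i = ∑_{j_1 < ⋯ < j_i} x_{j_1} ⋯ x_{j_i}` (so `e_0 = 1`). -/
def elem (i : ℕ) : MvPowerSeries ℕ ℚ :=
  monomialSum fun s : {s : Finset ℕ // s.card = i} => setExponent s.1

/-- `e_λ = e_{λ_1} e_{λ_2} ⋯` for a partition `λ` of any natural number. -/
def elemPart (p : Σ n : ℕ, n.Partition) : MvPowerSeries ℕ ℚ :=
  (p.2.parts.map elem).prod

/-- `f` is `e`-positive: it is a (finite) linear combination of the basis elements `e_λ`
with nonnegative coefficients. -/
def EPositive (f : MvPowerSeries ℕ ℚ) : Prop :=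
  ∃ c : (Σ n : ℕ, n.Partition) →₀ ℚ, (∀ p, 0 ≤ c p) ∧ f = c.sum fun p a => a • elemPart p

/-- The monomial `∏ v, x_{k v}` of a colouring `k`, as an exponent vector. -/
def colouringExponent {V : Type*} [Fintype V] (k : V → ℕ) : ℕ →₀ ℕ :=
  ∑ v, Finsupp.single (k v) 1

/-- The chromatic symmetric function `X_G = ∑_k ∏_v x_{k v}`, the sum being over all proper
colourings `k : V → ℕ` of `G`. -/
def chromaticSymm {V : Type*} [Fintype V] (G : SimpleGraph V) : MvPowerSeries ℕ ℚ :=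
  monomialSum fun k : G.Coloring ℕ => colouringExponent k

/-- The dumbbell graph `D(m, l, n)`, for `m, n ≥ 3` and `l ≥ -1`, on the vertices
`0, 1, …, m + l + n - 1`, consecutive vertices being adjacent.
The vertices `0, …, m - 1` form the cycle `C_m`, closed by the edge from `0` to `m - 1`.
The vertices `m, …, m + l - 1` form the path `P_l`, joined to the cycles by the edges from `m - 1`
to `m` and from `m + l - 1` to `m + l`.
The vertices `m + l, …, m + l + n - 1` form the cycle `C_n`, closed by the edge between its ends.
For `l = 0` the cycles are joined by the edge from `m - 1` to `m`;
for `l = -1` they share the vertex `m - 1`. -/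
def dumbbell (m : ℕ) (l : ℤ) (n : ℕ) : SimpleGraph (Fin (m + l + n).toNat) :=
  SimpleGraph.fromRel fun a b =>
    (b : ℤ) = a + 1 ∨
    ((a : ℤ) = 0 ∧ (b : ℤ) = m - 1) ∨
    ((a : ℤ) = m + l ∧ (b : ℤ) = m + l + n - 1)

theorem finite_elemFiber (i : ℕ) (d : ℕ →₀ ℕ) :
    Finite {s : {s : Finset ℕ // s.card = i} // setExponent s.1 = d} := by
  refine Finite.of_injective (β := {t : Finset ℕ // t ∈ d.support.powerset})
    (fun s => ⟨s.1.1, ?_⟩) ?_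
  · rw [Finset.mem_powerset]
    intro j hj
    have h : setExponent s.1.1 j = d j := by rw [s.2]
    rw [Finsupp.mem_support_iff, ← h]
    simp [setExponent, Finsupp.finsetSum_apply, Finsupp.single_apply, hj]
  · intro s t h
    have h2 : s.1.1 = t.1.1 := by simpa using h
    exact Subtype.ext (Subtype.ext h2)

theorem finite_colouringFiber {V : Type*} [Fintype V] (G : SimpleGraph V) (d : ℕ →₀ ℕ) :
    Finite {k : G.Coloring ℕ // colouringExponent k = d} := by
  refine Finite.of_injective (β := V → {j : ℕ // j ∈ d.support})
    (fun k v => ⟨k.1 v, ?_⟩) ?_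
  · have h : colouringExponent k.1 (k.1 v) = d (k.1 v) := by rw [k.2]
    rw [Finsupp.mem_support_iff, ← h]
    simp only [colouringExponent, Finsupp.finsetSum_apply, Finsupp.single_apply]
    intro h0
    have := (Finset.sum_eq_zero_iff.mp h0) v (Finset.mem_univ v)
    simp at this
  · intro k k' h
    apply Subtype.ext
    apply DFunLike.ext
    intro v
    exact congrArg Subtype.val (congrFun h v)

end Dumbbell

end

/-! Let `P n` be the chromatic symmetric function of the path on `n` vertices and `T r k` that of a
cycle of length `r + 1` with a tail of `k` vertices. Given the colour `d` of the apex of the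
triangle, an ordered pair of distinct colours `a`, `b` avoids `d` in both places with indicator `[d
≠ a] + [d ≠ b] - 1`, since `d` cannot equal both. Summing over pairs replaces the triangle by twice
a longer tail minus a detached edge. As `P 2 = 2 e_2`, the dumbbell with `k = l + 1` and `m = r + 1`
has function `2 (T r (k + 2) - e_2 T r k)` (`chromaticSymm_dumbbell`).

`P n` is the sum over compositions of `n` of (first part) times the product of (part - 1) over the
others, times `e` of the parts. Deletion-contraction on the closing edge of the cycle gives a
recursion for `T`, solved by a positive formula: a sum over the same compositions, cut at the part
that crosses position `k` (`cycleSum_tailSum`).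

The difference is then e-positive summand by summand: subtracting `e_2` times the shorter sum
cancels contributions already present in the longer one (`EPositive.pathSeq_sub`,
`EPositive.crossSeq_sub`).

Identities are proved for finitely many colours with transfer operators, then lifted to infinitely
many variables by truncation. -/

open Finset

namespace Dumbbell

/-! ### Composition formulas for paths and tadpoles in a commutative ring -/

section Recursion

variable {R : Type*} [CommRing R]

/-- The solution of `s 0 = u 0`, `s (n + 1) = u (n + 1) + ∑ i ≤ n, s i * g (n - i)`. -/
def recSeq (u g : ℕ → R) : ℕ → R
  | 0 => u 0
  | n + 1 => u (n + 1) + ∑ i : Fin (n + 1), recSeq u g i * g (n - i)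

theorem recSeq_zero (u g : ℕ → R) : recSeq u g 0 = u 0 := by rw [recSeq]

theorem recSeq_succ (u g : ℕ → R) (n : ℕ) :
    recSeq u g (n + 1) = u (n + 1) + ∑ p ∈ antidiagonal n, recSeq u g p.1 * g p.2 := by
  rw [recSeq, Finset.Nat.sum_antidiagonal_eq_sum_range_succ (fun i j => recSeq u g i * g j),
    Finset.sum_range]

theorem eq_recSeq {u g s : ℕ → R} (h0 : s 0 = u 0)
    (hs : ∀ n, s (n + 1) = u (n + 1) + ∑ p ∈ antidiagonal n, s p.1 * g p.2) (n : ℕ) :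
    s n = recSeq u g n := by
  induction n using Nat.strong_induction_on with
  | _ n ih =>
    cases n with
    | zero => rw [h0, recSeq_zero]
    | succ n =>
      rw [hs, recSeq_succ]
      congr 1
      refine sum_congr rfl fun p hp => ?_
      rw [ih p.1 (by have := mem_antidiagonal.1 hp; omega)]

theorem map_recSeq {R' : Type*} [CommRing R'] (φ : R →+* R') (u g : ℕ → R) (n : ℕ) :
    φ (recSeq u g n) = recSeq (fun i => φ (u i)) (fun i => φ (g i)) n := by
  refine eq_recSeq (s := fun n => φ (recSeq u g n)) ?_ (fun n => ?_) n
  · rw [recSeq_zero]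
  · simp [recSeq_succ, map_sum]

/-- The chromatic symmetric functions of paths, in terms of the elementary ones. -/
def pathSeq (e : ℕ → R) : ℕ → R := recSeq e fun b => b * e (b + 1)

/-- The coefficients of `1 / (1 - ∑ i, (i - 1) e_i z ^ i)`. -/
def wordSeq (e : ℕ → R) : ℕ → R := recSeq (fun n => if n = 0 then 1 else 0) fun b => b * e (b + 1)

/-- The contribution to `P_{k + 1 + i}` of the compositions having a part that ends at
`k + 1 + i`, the last one, and starts at `k` or before. -/
def crossSeq (e : ℕ → R) (i k : ℕ) : R :=
  e (k + 1 + i) + ∑ p ∈ antidiagonal k, pathSeq e p.1 * ((p.2 + i : ℕ) * e (p.2 + 1 + i))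

/-- The chromatic symmetric function of a cycle of length `r + 1` with a tail of length `k`. -/
def tadpoleSeq (e : ℕ → R) (r k : ℕ) : R :=
  ∑ p ∈ antidiagonal r, p.1 * wordSeq e p.2 * crossSeq e p.1 k

variable (e : ℕ → R)

theorem pathSeq_succ (n : ℕ) : pathSeq e (n + 1) =
    e (n + 1) + ∑ p ∈ antidiagonal n, pathSeq e p.1 * (p.2 * e (p.2 + 1)) :=
  recSeq_succ _ _ _

theorem wordSeq_zero : wordSeq e 0 = 1 := by simp [wordSeq, recSeq_zero]

theorem wordSeq_succ (n : ℕ) : wordSeq e (n + 1) =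
    ∑ p ∈ antidiagonal n, p.1 * e (p.1 + 1) * wordSeq e p.2 := by
  rw [← Finset.Nat.sum_antidiagonal_swap, wordSeq, recSeq_succ]
  simp [mul_comm]

theorem pathSeq_zero (he : e 0 = 1) : pathSeq e 0 = 1 := by rw [pathSeq, recSeq_zero, he]

theorem pathSeq_two (he : e 0 = 1) : pathSeq e 2 = 2 * e 2 := by
  rw [pathSeq_succ, Finset.Nat.antidiagonal_succ]
  simp [pathSeq_zero e he]
  ring

theorem crossSeq_zero_left (k : ℕ) : crossSeq e 0 k = pathSeq e (k + 1) := by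
  rw [pathSeq_succ]
  simp [crossSeq]

theorem crossSeq_zero_right (he : e 0 = 1) (i : ℕ) : crossSeq e i 0 = (i + 1) * e (i + 1) := by
  simp [crossSeq, pathSeq_zero e he, add_comm 1 i]
  ring

/-- Both sides concern a last part ending at `k + 2 + i`; requiring it to start at `k` or before,
instead of `k + 1`, discards just the term with a part of size `i + 1` after a prefix of total `k +
1`. -/
theorem crossSeq_succ_left (i k : ℕ) :
    crossSeq e (i + 1) k = crossSeq e i (k + 1) - i * e (i + 1) * pathSeq e (k + 1) := by
  have h : ∀ b : ℕ, b + 1 + 1 + i = b + 1 + (i + 1) := fun b => by omega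
  have h' : ∀ b : ℕ, b + 1 + i = b + (i + 1) := fun b => by omega
  rw [crossSeq, crossSeq, Finset.Nat.antidiagonal_succ']
  simp only [sum_cons, sum_map, Function.Embedding.prodMap, Function.Embedding.coeFn_mk,
    Function.Embedding.refl_apply, Prod.map, h, Nat.succ_eq_add_one, zero_add, h']
  ring

/-- Each composition of `m + 1 + k` has exactly one part that starts at `k` or before and ends at `k
+ 1` or after; `crossSeq` counts everything up to that part and `wordSeq` the rest. -/
theorem sum_wordSeq_mul_crossSeq (m k : ℕ) :
    ∑ p ∈ antidiagonal m, wordSeq e p.2 * crossSeq e p.1 k = pathSeq e (m + 1 + k) := by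
  induction m generalizing k with
  | zero => simp [wordSeq_zero, crossSeq_zero_left, add_comm]
  | succ m ih =>
    rw [Finset.Nat.antidiagonal_succ]
    simp only [sum_cons, sum_map, Function.Embedding.prodMap, Function.Embedding.coeFn_mk,
      Function.Embedding.refl_apply, Prod.map, Nat.succ_eq_add_one, crossSeq_succ_left, mul_sub,
      sum_sub_distrib, ih, crossSeq_zero_left]
    rw [wordSeq_succ, sum_mul, show m + 1 + 1 + k = m + 1 + (k + 1) by omega]
    rw [sum_congr rfl fun (p : ℕ × ℕ) _ => show
      wordSeq e p.2 * (p.1 * e (p.1 + 1) * pathSeq e (k + 1)) =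
        p.1 * e (p.1 + 1) * wordSeq e p.2 * pathSeq e (k + 1) by ring]
    ring

theorem tadpoleSeq_zero (k : ℕ) : tadpoleSeq e 0 k = 0 := by simp [tadpoleSeq]

/-- Shifting the index turns the weight `i` into `i + 1`; the extra copy of the sum comes from the
path term, through `sum_wordSeq_mul_crossSeq`. -/
theorem tadpoleSeq_succ (he : e 0 = 1) (r k : ℕ) : tadpoleSeq e (r + 1) k =
    tadpoleSeq e r (k + 1) - tadpoleSeq e r 0 * pathSeq e (k + 1) + pathSeq e (r + k + 2) := by
  have h := sum_wordSeq_mul_crossSeq e (r + 1) k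
  rw [Finset.Nat.antidiagonal_succ] at h
  rw [tadpoleSeq, Finset.Nat.antidiagonal_succ]
  simp only [sum_cons, sum_map, Function.Embedding.prodMap, Function.Embedding.coeFn_mk,
      Function.Embedding.refl_apply, Prod.map, Nat.succ_eq_add_one, crossSeq_zero_left] at h ⊢
  rw [show r + k + 2 = r + 1 + 1 + k by omega, ← h, wordSeq_succ, tadpoleSeq, tadpoleSeq,
    sum_mul, sum_mul, ← add_assoc, ← sum_sub_distrib, ← sum_add_distrib, Nat.cast_zero,
    zero_mul, zero_mul, zero_add, ← sum_add_distrib]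
  refine sum_congr rfl fun p _ => ?_
  rw [crossSeq_zero_right e he, crossSeq_succ_left]
  push_cast
  ring

/-- A recursion that determines the chromatic symmetric functions of tadpoles. -/
theorem eq_tadpoleSeq (he : e 0 = 1) {T : ℕ → ℕ → R} (h0 : ∀ k, T 0 k = 0)
    (hT : ∀ r k, T (r + 1) k =
      T r (k + 1) - T r 0 * pathSeq e (k + 1) + pathSeq e (r + k + 2)) (r k : ℕ) :
    T r k = tadpoleSeq e r k := by
  induction r generalizing k with
  | zero => rw [h0, tadpoleSeq_zero]
  | succ r ih => rw [hT, ih, ih, tadpoleSeq_succ e he]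

theorem map_pathSeq {R' : Type*} [CommRing R'] (φ : R →+* R') (n : ℕ) :
    φ (pathSeq e n) = pathSeq (fun i => φ (e i)) n := by
  simp [pathSeq, map_recSeq]

theorem map_wordSeq {R' : Type*} [CommRing R'] (φ : R →+* R') (n : ℕ) :
    φ (wordSeq e n) = wordSeq (fun i => φ (e i)) n := by
  simp [wordSeq, map_recSeq, apply_ite φ]

theorem map_tadpoleSeq {R' : Type*} [CommRing R'] (φ : R →+* R') (r k : ℕ) :
    φ (tadpoleSeq e r k) = tadpoleSeq (fun i => φ (e i)) r k := by
  simp [tadpoleSeq, crossSeq, map_pathSeq, map_wordSeq, map_sum]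

end Recursion

/-! ### Transfer operators: paths and cycles in finitely many colours -/

section Words

variable {R ι : Type*} [CommRing R] [Fintype ι] [DecidableEq ι] (x : ι → R)

/-- The transfer operator for proper words weighted by `x`. -/
def transfer (f : ι → R) (d : ι) : R := ∑ b, if d ≠ b then x b * f b else 0

/-- The sum over the proper words `c w_1 ⋯ w_n` of `x_{w_1} ⋯ x_{w_n} g w`. -/
def chainSum (n : ℕ) (c : ι) (g : (Fin n → ι) → R) : R :=
  ∑ w : Fin n → ι,
    if ∀ i : Fin n, (Fin.cons c w : Fin (n + 1) → ι) i.castSucc ≠ w i then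
      (∏ i, x (w i)) * g w else 0

theorem chainSum_succ (n : ℕ) (c : ι) (g : (Fin (n + 1) → ι) → R) :
    chainSum x (n + 1) c g = transfer x (fun b => chainSum x n b fun w => g (Fin.cons b w)) c := by
  rw [chainSum, ← (Fin.consEquiv fun _ : Fin (n + 1) => ι).sum_comp, Fintype.sum_prod_type]
  refine sum_congr rfl fun b _ => ?_
  split_ifs with h
  · simp only [chainSum, mul_sum]
    refine sum_congr rfl fun w _ => ?_
    simp only [Fin.consEquiv_apply, Fin.forall_fin_succ, Fin.prod_univ_succ, Fin.cons_zero,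
      Fin.cons_succ, Fin.castSucc_zero, ← Fin.succ_castSucc, mul_ite, mul_zero, h, true_and,
      mul_assoc, ne_eq, not_false_eq_true]
    rfl
  · refine sum_eq_zero fun w _ => if_neg fun h' => h ?_
    simpa using h' 0

/-- A weight that sees only the letter at position `p` and the later ones lets the first `p` steps
be summed out as powers of the transfer operator. -/
theorem chainSum_add (n p : ℕ) (c : ι) (g : ι → (Fin n → ι) → R) :
    chainSum x (n + p) c (fun w => g ((Fin.cons c w : Fin (n + p + 1) → ι) ⟨p, by omega⟩)
      fun i => w ⟨i + p, by omega⟩) = (transfer x)^[p] (fun d => chainSum x n d (g d)) c := by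
  induction p generalizing c with
  | zero => rfl
  | succ p ih =>
    rw [Function.iterate_succ_apply', ← funext ih]
    exact chainSum_succ x (n + p) c _

theorem transfer_eq (f : ι → R) : transfer x f = fun d => ∑ b, x b * f b - x d * f d := by
  funext d
  rw [transfer, ← Finset.sum_erase_eq_sub (mem_univ d), ← Finset.sum_filter]
  congr 1
  ext b
  simp [eq_comm]

theorem transfer_add (f g : ι → R) : transfer x (f + g) = transfer x f + transfer x g := by
  funext d
  simp only [transfer_eq, Pi.add_apply, mul_add, sum_add_distrib]
  ring

theorem transfer_smul (a : R) (f : ι → R) : transfer x (a • f) = a • transfer x f := by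
  funext d
  simp only [transfer_eq, Pi.smul_apply, smul_eq_mul, mul_sub, mul_sum]
  congr 1
  · exact sum_congr rfl fun _ _ => by ring
  · ring

/-- The transfer operator as a linear map. -/
def transferₗ : (ι → R) →ₗ[R] (ι → R) where
  toFun := transfer x
  map_add' := transfer_add x
  map_smul' := transfer_smul x

theorem transferₗ_pow_succ (n : ℕ) (f : ι → R) (d : ι) : (transferₗ x ^ (n + 1)) f d =
    ∑ b, x b * (transferₗ x ^ n) f b - x d * (transferₗ x ^ n) f d := by
  rw [pow_succ', Module.End.mul_apply]
  exact congrFun (transfer_eq x _) d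

/-- Reversal of words: the relation `d ≠ b` is symmetric, so the operator is self-adjoint for the
form weighted by `x`. -/
theorem transferₗ_symm (f g : ι → R) :
    ∑ b, x b * (transferₗ x f b * g b) = ∑ b, x b * (f b * transferₗ x g b) := by
  have h : ∀ f g : ι → R, ∑ b, x b * (transferₗ x f b * g b) =
      (∑ b, x b * f b) * (∑ b, x b * g b) - ∑ b, x b * (x b * f b * g b) := by
    intro f g
    change ∑ b, x b * (transfer x f b * g b) = _
    rw [transfer_eq, mul_sum, ← sum_sub_distrib]
    exact sum_congr rfl fun _ _ => by ring
  rw [h, sum_congr rfl fun b _ => show x b * (f b * transferₗ x g b) =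
    x b * (transferₗ x g b * f b) by ring, h]
  congr 1
  · ring
  · exact sum_congr rfl fun _ _ => by ring

theorem transferₗ_pow_symm (n : ℕ) (f g : ι → R) :
    ∑ b, x b * ((transferₗ x ^ n) f b * g b) = ∑ b, x b * (f b * (transferₗ x ^ n) g b) := by
  induction n generalizing g with
  | zero => rfl
  | succ n ih =>
    rw [pow_succ', Module.End.mul_apply, transferₗ_symm, ih, ← Module.End.mul_apply, ← pow_succ,
      pow_succ']

/-- The sum over the proper words of length `n` that may follow the letter `d`. -/
def tailSum (n : ℕ) : ι → R := (transferₗ x ^ n) 1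

/-- The sum over the proper words of length `n`. -/
def pathSum : ℕ → R
  | 0 => 1
  | n + 1 => ∑ d, x d * tailSum x n d

/-- The sum over the proper cyclic words of length `r + 1`, weighted by the value of `h` at the
last letter. -/
def cycleSum (r : ℕ) (h : ι → R) : R :=
  ∑ c, x c * (transferₗ x ^ r) (fun d => if d ≠ c then h d else 0) c

theorem tailSum_zero : tailSum x 0 = 1 := rfl

/-- All words minus those that begin with the forbidden letter `d`. This trades the factor `x d`
produced by contraction for a longer tail. -/
theorem tailSum_succ (n : ℕ) :
    tailSum x (n + 1) = pathSum x (n + 1) • (1 : ι → R) - fun d => x d * tailSum x n d := by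
  funext d
  simp [tailSum, transferₗ_pow_succ, pathSum]

theorem sum_tailSum_mul_tailSum (m k : ℕ) :
    ∑ d, x d * (tailSum x m d * tailSum x k d) = pathSum x (m + k + 1) := by
  rw [tailSum, tailSum, transferₗ_pow_symm, ← Module.End.mul_apply, ← pow_add]
  simp [pathSum, tailSum]

theorem cycleSum_add (r : ℕ) (h h' : ι → R) :
    cycleSum x r (h + h') = cycleSum x r h + cycleSum x r h' := by
  rw [cycleSum, cycleSum, cycleSum, ← sum_add_distrib]
  refine sum_congr rfl fun c _ => ?_
  rw [← mul_add, ← Pi.add_apply, ← map_add]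
  congr 1
  refine congrFun (congrArg _ (funext fun d => ?_)) c
  simp only [Pi.add_apply]
  split_ifs <;> simp

theorem cycleSum_smul (r : ℕ) (a : R) (h : ι → R) :
    cycleSum x r (a • h) = a * cycleSum x r h := by
  rw [cycleSum, cycleSum, mul_sum]
  refine sum_congr rfl fun c _ => ?_
  rw [mul_left_comm, ← smul_eq_mul (a := a), ← Pi.smul_apply, ← map_smul]
  congr 1
  refine congrFun (congrArg _ (funext fun d => ?_)) c
  simp only [Pi.smul_apply]
  split_ifs <;> simp

theorem cycleSum_sub (r : ℕ) (h h' : ι → R) :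
    cycleSum x r (h - h') = cycleSum x r h - cycleSum x r h' := by
  rw [sub_eq_add_neg, ← neg_one_smul R h', cycleSum_add, cycleSum_smul]
  ring

theorem cycleSum_zero (h : ι → R) : cycleSum x 0 h = 0 := by simp [cycleSum]

theorem cycleSum_eq (r : ℕ) (h : ι → R) : cycleSum x r h =
    ∑ c, x c * (tailSum x r c * h c) - ∑ c, x c * (h c * (transferₗ x ^ r) (Pi.single c 1) c) := by
  have h1 := transferₗ_pow_symm x r 1 h
  rw [tailSum, h1, cycleSum, ← sum_sub_distrib]
  refine sum_congr rfl fun c _ => ?_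
  have : (fun d => if d ≠ c then h d else 0) = h - h c • Pi.single c (1 : R) := by
    funext d
    by_cases hd : d = c
    · subst hd; simp
    · simp [hd]
  rw [this, map_sub, map_smul]
  simp
  ring

/-- Deletion-contraction on the closing edge: open words, minus those with equal end letters, which
glue to a shorter cycle whose last letter carries an extra `x d`. -/
theorem cycleSum_succ (r : ℕ) (h : ι → R) : cycleSum x (r + 1) h =
    ∑ c, x c * (tailSum x (r + 1) c * h c) - cycleSum x r (fun d => x d * h d) := by
  rw [cycleSum_eq, cycleSum_eq]
  congr 1
  rw [← sum_sub_distrib]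
  refine sum_congr rfl fun c _ => ?_
  -- Self-adjointness evaluates the full sum in `transferₗ_pow_succ` as `x c * tailSum x r c`.
  have h1 := transferₗ_pow_symm x r 1 (Pi.single c 1)
  simp only [Pi.single_apply, mul_ite, mul_one, mul_zero, sum_ite_eq', mem_univ, if_true,
    Pi.one_apply, one_mul] at h1
  rw [transferₗ_pow_succ, ← h1, tailSum]
  ring

theorem cycleSum_tailSum_succ (r k : ℕ) : cycleSum x (r + 1) (tailSum x k) =
    cycleSum x r (tailSum x (k + 1)) - cycleSum x r (tailSum x 0) * pathSum x (k + 1) +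
      pathSum x (r + k + 2) := by
  rw [cycleSum_succ, sum_tailSum_mul_tailSum, tailSum_succ, cycleSum_sub, cycleSum_smul,
    tailSum_zero, show r + 1 + k + 1 = r + k + 2 by omega]
  ring

end Words

/-! ### Elementary symmetric expansions; the dumbbell in terms of tadpoles -/

section Words

variable {R ι : Type*} [CommRing R] [Fintype ι] (x : ι → R)

/-- The elementary symmetric polynomials evaluated at `x`. -/
def elemSum (j : ℕ) : R := ∑ s ∈ powersetCard j univ, ∏ i ∈ s, x i

theorem elemSum_zero : elemSum x 0 = 1 := by simp [elemSum]

open Polynomial in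
theorem coeff_prod_one_add_C_mul_X (j : ℕ) :
    (∏ d, (1 + C (x d) * X) : R[X]).coeff j = elemSum x j := by
  rw [prod_one_add, finsetSum_coeff, elemSum, powersetCard_eq_filter, sum_filter]
  refine sum_congr rfl fun s _ => ?_
  rw [prod_mul_distrib, prod_const, ← map_prod, coeff_C_mul, coeff_X_pow]
  simp [eq_comm]

variable [DecidableEq ι]

-- With `A_d = ∑ tailSum x n d z ^ n`, one has `A_d (1 + x_d z) = P` and `P - 1 = z ∑ x_d A_d`.
-- Multiplying the latter by `E = ∏ (1 + x_d z)` leaves `z P ∑ x_d ∏_{b ≠ d} (1 + x_b z)`, which is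
-- `z E' P`.
open PowerSeries in
theorem pathSum_series : (PowerSeries.mk (pathSum x) - 1) * PowerSeries.mk (elemSum x) =
    X * d⁄dX R (PowerSeries.mk (elemSum x)) * PowerSeries.mk (pathSum x) := by
  set P : R⟦X⟧ := PowerSeries.mk (pathSum x)
  have hA : ∀ d, (PowerSeries.mk fun n => tailSum x n d) * (1 + C (x d) * X) = P := by
    intro d
    ext n
    rw [mul_add, mul_one, ← mul_assoc, map_add, mul_comm _ (C (x d)), mul_assoc]
    cases n with
    | zero => simp [P, pathSum, tailSum_zero]
    | succ n =>
      rw [coeff_C_mul, coeff_succ_mul_X]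
      simp [P, tailSum_succ]
  have hP : P - 1 = X * ∑ d, C (x d) * (PowerSeries.mk fun n => tailSum x n d) := by
    ext n
    cases n with
    | zero => simp [P, pathSum]
    | succ n =>
      rw [coeff_succ_X_mul]
      simp [P, pathSum, coeff_one, map_sum]
  have hE : (PowerSeries.mk (elemSum x) : R⟦X⟧) =
      ((∏ d, (1 + Polynomial.C (x d) * Polynomial.X) : Polynomial R) : R⟦X⟧) := by
    ext n
    rw [Polynomial.coeff_coe, coeff_prod_one_add_C_mul_X, coeff_mk]
  have hE' : ∀ d, (PowerSeries.mk (elemSum x) : R⟦X⟧) = (1 + C (x d) * X) *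
      ((∏ b ∈ univ.erase d, (1 + Polynomial.C (x b) * Polynomial.X) : Polynomial R) : R⟦X⟧) := by
    intro d
    rw [hE, ← mul_prod_erase _ _ (mem_univ d)]
    simp
  have hD : d⁄dX R (PowerSeries.mk (elemSum x)) = ∑ d, C (x d) *
      ((∏ b ∈ univ.erase d, (1 + Polynomial.C (x b) * Polynomial.X) : Polynomial R) : R⟦X⟧) := by
    rw [hE, derivative_coe, Polynomial.derivative_prod_finset,
      ← Polynomial.coeToPowerSeries.ringHom_apply, map_sum]
    refine sum_congr rfl fun d _ => ?_
    rw [mul_comm, map_mul]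
    congr 1
    simp
  rw [hP, hD, mul_assoc, mul_assoc, sum_mul, sum_mul]
  congr 1
  refine sum_congr rfl fun d _ => ?_
  rw [hE' d, ← hA d]
  ring

theorem pathSum_eq (n : ℕ) : pathSum x n = pathSeq (elemSum x) n := by
  refine eq_recSeq ?_ (fun n => ?_) n
  · rw [elemSum_zero, pathSum]
  · have h := congrArg (PowerSeries.coeff (n + 1)) (pathSum_series x)
    rw [sub_mul, one_mul, map_sub, mul_assoc, PowerSeries.coeff_succ_X_mul, mul_comm
      (PowerSeries.derivative R _), PowerSeries.coeff_mul,
      PowerSeries.coeff_mul, Finset.Nat.antidiagonal_succ'] at h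
    simp only [sum_cons, sum_map, Function.Embedding.prodMap, Function.Embedding.coeFn_mk,
      Function.Embedding.refl_apply, Prod.map, Nat.succ_eq_add_one, PowerSeries.coeff_mk,
      elemSum_zero, mul_one, PowerSeries.coeff_derivative] at h
    rw [sum_congr rfl fun (p : ℕ × ℕ) _ => show pathSum x p.1 * (elemSum x (p.2 + 1) * (p.2 + 1)) =
      pathSum x p.1 * (p.2 * elemSum x (p.2 + 1)) + pathSum x p.1 * elemSum x (p.2 + 1) by ring,
      sum_add_distrib] at h
    linear_combination h

theorem cycleSum_tailSum (r k : ℕ) :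
    cycleSum x r (tailSum x k) = tadpoleSeq (elemSum x) r k := by
  refine eq_tadpoleSeq (T := fun r k => cycleSum x r (tailSum x k)) _ (elemSum_zero x)
    (fun k => cycleSum_zero x _) (fun r k => ?_) r k
  rw [← pathSum_eq, ← pathSum_eq]
  exact cycleSum_tailSum_succ x r k

/-- The proper colourings of the dumbbell graph `D(r + 1, k - 1, 3)`. -/
def IsDumbbellWord {α : Type*} (r k : ℕ) (w : Fin (2 + k + r + 1) → α) : Prop :=
  (∀ i : Fin (2 + k + r), w i.castSucc ≠ w i.succ) ∧ w ⟨r, by omega⟩ ≠ w 0 ∧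
    w ⟨k + r, by omega⟩ ≠ w ⟨k + 2 + r, by omega⟩

/-- The weighted sum over the ends of a triangle with a given apex. -/
theorem chainSum_two (d : ι) : chainSum x 2 d (fun v => if d ≠ v 1 then 1 else 0) =
    2 * tailSum x 2 d - pathSum x 2 := by
  have h1 : ∀ f : ι → R, ∀ d, transfer x f d = ∑ b, x b * (if d ≠ b then f b else 0) := by
    intro f d
    simp [transfer]
  have h2 : ∀ f c, chainSum x 0 c f = f Fin.elim0 := by
    intro f c
    rw [chainSum, Fintype.sum_unique]
    simp only [IsEmpty.forall_iff, if_true, univ_eq_empty, prod_empty, one_mul]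
    exact congrArg f (Subsingleton.elim _ _)
  have hA : ∀ d, tailSum x 1 d = ∑ b, x b * (if d ≠ b then 1 else 0) := by
    intro d
    rw [tailSum, pow_one]
    exact h1 1 d
  have hB : tailSum x 2 d = ∑ a, x a * (if d ≠ a then tailSum x 1 a else 0) := by
    rw [← h1]
    simp only [tailSum, pow_succ' _ 1, Module.End.mul_apply]
    rfl
  have hC : tailSum x 2 d = ∑ a, ∑ b, x a * x b * ((if a ≠ b then 1 else 0) *
      if d ≠ a then 1 else 0) := by
    rw [hB]
    refine sum_congr rfl fun a _ => ?_
    split_ifs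
    · rw [hA, mul_sum]
      refine sum_congr rfl fun b _ => ?_
      rw [mul_one, mul_assoc]
    · simp
  have hC' : tailSum x 2 d = ∑ a, ∑ b, x a * x b * ((if a ≠ b then 1 else 0) *
      if d ≠ b then 1 else 0) := by
    rw [hC, sum_comm]
    refine sum_congr rfl fun a _ => sum_congr rfl fun b _ => ?_
    simp only [mul_comm (x b), ne_comm (a := b)]
  have hD : pathSum x 2 = ∑ a, ∑ b, x a * x b * (if a ≠ b then 1 else 0) := by
    rw [pathSum]
    refine sum_congr rfl fun a _ => ?_
    rw [hA, mul_sum]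
    exact sum_congr rfl fun b _ => by rw [mul_assoc]
  -- The two copies of `tailSum x 2 d` test `d` against the first and the second letter
  -- respectively, so the identity becomes `[d ≠ a][d ≠ b] = [d ≠ a] + [d ≠ b] - 1` for `a ≠ b`.
  rw [chainSum_succ, h1, two_mul]
  nth_rw 1 [hC]
  rw [hC', hD, ← sum_add_distrib, ← sum_sub_distrib]
  refine sum_congr rfl fun a _ => ?_
  rw [← sum_add_distrib, ← sum_sub_distrib]
  by_cases hda : d = a
  · rw [if_neg (not_not.2 hda), mul_zero, eq_comm]
    refine sum_eq_zero fun b _ => ?_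
    subst hda
    by_cases hdb : d = b <;> simp [hdb]
  rw [if_pos hda, chainSum_succ, h1, mul_sum]
  refine sum_congr rfl fun b _ => ?_
  rw [h2]
  change x a * (x b * (if a ≠ b then (if d ≠ b then 1 else 0) else 0)) = _
  by_cases hdb : d = b <;> by_cases hab : a = b <;> simp_all

-- The word is cut at position `r`, where the cycle closes, and at `k + r`, the apex of the
-- triangle; `chainSum_two` then makes the weight at position `r` a combination of two tails.
open Classical in
theorem sum_isDumbbellWord (r k : ℕ) :
    (∑ w : Fin (2 + k + r + 1) → ι, if IsDumbbellWord r k w then ∏ i, x (w i) else 0) =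
      2 * (tadpoleSeq (elemSum x) r (k + 2) - elemSum x 2 * tadpoleSeq (elemSum x) r k) := by
  have hcons : ∀ (c : ι) (w : Fin (2 + k + r) → ι), ∀ (j : ℕ) (hj : j < 2 + k + 1),
      (Fin.cons ((Fin.cons c w : Fin (2 + k + r + 1) → ι) ⟨r, by omega⟩)
        (fun i : Fin (2 + k) => w ⟨i + r, by omega⟩) : Fin (2 + k + 1) → ι) ⟨j, hj⟩ =
        (Fin.cons c w : Fin (2 + k + r + 1) → ι) ⟨j + r, by omega⟩ := by
    intro c w j hj
    cases j with
    | zero => simp only [zero_add]; rfl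
    | succ j => simp only [Nat.succ_add]; rfl
  have hB : (transfer x)^[k] (fun d => chainSum x 2 d (fun v => if d ≠ v 1 then 1 else 0)) =
      (2 : R) • tailSum x (k + 2) - pathSum x 2 • tailSum x k := by
    have : (fun d => chainSum x 2 d (fun v => if d ≠ v 1 then 1 else 0)) =
        (2 : R) • tailSum x 2 - pathSum x 2 • (1 : ι → R) := by
      funext d
      rw [chainSum_two]
      simp
    rw [this]
    change (transferₗ x)^[k] _ = _
    rw [← Module.End.coe_pow, map_sub, map_smul, map_smul, tailSum, tailSum, tailSum, pow_add,
      Module.End.mul_apply]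
  have hP : pathSum x 2 = 2 * elemSum x 2 := by
    rw [pathSum_eq, pathSeq_two _ (elemSum_zero x)]
  have hK : ∀ c, chainSum x (2 + k + r) c (fun w =>
      if (Fin.cons c w : Fin (2 + k + r + 1) → ι) ⟨r, by omega⟩ ≠ c then
        (if (Fin.cons c w : Fin (2 + k + r + 1) → ι) ⟨k + r, by omega⟩ ≠
          (Fin.cons c w : Fin (2 + k + r + 1) → ι) ⟨k + 2 + r, by omega⟩ then 1 else 0) else 0) =
      (transferₗ x ^ r) (fun d => if d ≠ c then
        ((2 : R) • tailSum x (k + 2) - pathSum x 2 • tailSum x k) d else 0) c := by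
    intro c
    rw [← hB, Module.End.coe_pow]
    have := chainSum_add x (2 + k) r c (fun d v => if d ≠ c then
      (if (Fin.cons d v : Fin (2 + k + 1) → ι) ⟨k, by omega⟩ ≠
        (Fin.cons d v : Fin (2 + k + 1) → ι) ⟨k + 2, by omega⟩ then 1 else 0) else 0)
    simp only [hcons] at this
    rw [this]
    change (transfer x)^[r] _ c = (transfer x)^[r] _ c
    refine congrFun (congrArg _ (funext fun d => ?_)) c
    by_cases hd : d = c
    · simp [hd, chainSum]
    · simp only [ne_eq, hd, not_false_eq_true, if_true]
      have hv : ∀ v : Fin (2 + k) → ι, (Fin.cons d v : Fin (2 + k + 1) → ι) ⟨k + 2, by omega⟩ =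
          (fun i : Fin 2 => v ⟨i + k, by omega⟩) 1 := fun v =>
        congrArg v (Fin.ext (Nat.add_comm k 1))
      simp only [hv]
      exact chainSum_add x 2 k d (fun d v => if d ≠ v 1 then 1 else 0)
  calc
    _ = cycleSum x r ((2 : R) • tailSum x (k + 2) - pathSum x 2 • tailSum x k) := by
      rw [cycleSum, ← (Fin.consEquiv fun _ : Fin (2 + k + r + 1) => ι).sum_comp,
        Fintype.sum_prod_type]
      refine sum_congr rfl fun c _ => ?_
      rw [← hK, chainSum, mul_sum]
      refine sum_congr rfl fun w _ => ?_
      change (if IsDumbbellWord r k (Fin.cons c w : Fin (2 + k + r + 1) → ι) then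
        ∏ i, x ((Fin.cons c w : Fin (2 + k + r + 1) → ι) i) else 0) = _
      rw [Fin.prod_univ_succ]
      simp only [IsDumbbellWord, Fin.cons_zero, Fin.cons_succ]
      split_ifs <;> simp_all
    _ = _ := by
      rw [cycleSum_sub, cycleSum_smul, cycleSum_smul, cycleSum_tailSum, cycleSum_tailSum, hP]
      ring

end Words

/-! ### e-positivity of the tadpole difference -/

section Positivity

theorem elem_zero : elem 0 = 1 := by
  ext d
  rw [MvPowerSeries.coeff_one]
  change (Nat.card {s : {s : Finset ℕ // s.card = 0} // setExponent s.1 = d} : ℚ) = _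
  split_ifs with h
  · subst h
    rw [Nat.cast_eq_one, Nat.card_eq_one_iff_unique]
    refine ⟨⟨fun s t => Subtype.ext (Subtype.ext ?_)⟩, ⟨⟨⟨∅, rfl⟩, rfl⟩⟩⟩
    rw [Finset.card_eq_zero.1 s.1.2, Finset.card_eq_zero.1 t.1.2]
  · rw [Nat.cast_eq_zero, Nat.card_eq_zero]
    left
    refine ⟨fun s => h ?_⟩
    rw [← s.2, Finset.card_eq_zero.1 s.1.2]
    rfl

theorem EPositive.zero : EPositive 0 := ⟨0, fun _ => le_rfl, by simp⟩

theorem EPositive.add {f g : MvPowerSeries ℕ ℚ} (hf : EPositive f) (hg : EPositive g) :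
    EPositive (f + g) := by
  obtain ⟨c, hc, rfl⟩ := hf
  obtain ⟨c', hc', rfl⟩ := hg
  refine ⟨c + c', fun p => add_nonneg (hc p) (hc' p), ?_⟩
  rw [Finsupp.sum_add_index'] <;> simp [add_smul]

theorem EPositive.sum {κ : Type*} {s : Finset κ} {f : κ → MvPowerSeries ℕ ℚ}
    (h : ∀ i ∈ s, EPositive (f i)) : EPositive (∑ i ∈ s, f i) :=
  Finset.sum_induction _ _ (fun _ _ => EPositive.add) EPositive.zero h

theorem EPositive.smul_elemPart {a : ℚ} (ha : 0 ≤ a) (p : Σ n : ℕ, n.Partition) :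
    EPositive (a • elemPart p) := by
  classical
  refine ⟨Finsupp.single p a, fun q => ?_, by simp⟩
  rw [Finsupp.single_apply]
  split_ifs <;> simp [ha]

theorem exists_elemPart_mul (p q : Σ n : ℕ, n.Partition) :
    ∃ r, elemPart p * elemPart q = elemPart r :=
  ⟨⟨p.1 + q.1, ⟨p.2.parts + q.2.parts, by
    intro i hi
    rcases Multiset.mem_add.1 hi with h | h
    exacts [p.2.parts_pos h, q.2.parts_pos h], by simp [p.2.parts_sum, q.2.parts_sum]⟩⟩,
    by simp [elemPart]⟩

theorem EPositive.mul {f g : MvPowerSeries ℕ ℚ} (hf : EPositive f) (hg : EPositive g) :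
    EPositive (f * g) := by
  obtain ⟨c, hc, rfl⟩ := hf
  obtain ⟨c', hc', rfl⟩ := hg
  rw [Finsupp.sum, Finsupp.sum, sum_mul_sum]
  refine EPositive.sum fun p _ => EPositive.sum fun q _ => ?_
  obtain ⟨r, hr⟩ := exists_elemPart_mul p q
  rw [smul_mul_smul_comm, hr]
  exact EPositive.smul_elemPart (mul_nonneg (hc p) (hc' q)) r

theorem EPositive.one : EPositive 1 := by
  have := EPositive.smul_elemPart zero_le_one ⟨0, ⟨0, by simp, by simp⟩⟩
  simpa [elemPart] using this

theorem EPositive.natCast (n : ℕ) : EPositive (n : MvPowerSeries ℕ ℚ) := by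
  induction n with
  | zero => simpa using EPositive.zero
  | succ n ih => simpa using ih.add EPositive.one

theorem EPositive.elem (i : ℕ) : EPositive (elem i) := by
  cases i with
  | zero => rw [elem_zero]; exact EPositive.one
  | succ i =>
    have := EPositive.smul_elemPart zero_le_one
      ⟨i + 1, ⟨{i + 1}, by simp, by simp⟩⟩
    simpa [elemPart] using this

theorem EPositive.recSeq {u g : ℕ → MvPowerSeries ℕ ℚ} (hu : ∀ n, EPositive (u n))
    (hg : ∀ n, EPositive (g n)) (n : ℕ) : EPositive (recSeq u g n) := by
  induction n using Nat.strong_induction_on with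
  | _ n ih =>
    cases n with
    | zero => rw [recSeq_zero]; exact hu 0
    | succ n =>
      rw [recSeq_succ]
      exact (hu _).add (EPositive.sum fun p hp =>
        (ih p.1 (by have := mem_antidiagonal.1 hp; omega)).mul (hg _))

theorem EPositive.pathSeq (n : ℕ) : EPositive (pathSeq Dumbbell.elem n) :=
  EPositive.recSeq EPositive.elem (fun b => (EPositive.natCast b).mul (EPositive.elem _)) n

theorem EPositive.wordSeq (n : ℕ) : EPositive (wordSeq Dumbbell.elem n) := by
  refine EPositive.recSeq (fun n => ?_)
    (fun b => (EPositive.natCast b).mul (EPositive.elem _)) n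
  split_ifs
  exacts [EPositive.one, EPositive.zero]

theorem pathSeq_two_sub (e : ℕ → MvPowerSeries ℕ ℚ) (he : e 0 = 1) :
    pathSeq e 2 - e 2 * pathSeq e 0 = e 2 := by
  rw [pathSeq_two e he, pathSeq_zero e he]
  ring

/-- The recursion for the longer path contains the term with last part `2`, which is exactly `e_2`
times the shorter path; the other terms are positive. -/
theorem EPositive.pathSeq_sub (a : ℕ) : EPositive (Dumbbell.pathSeq Dumbbell.elem (a + 2) -
    Dumbbell.elem 2 * Dumbbell.pathSeq Dumbbell.elem a) := by
  cases a with
  | zero => rw [pathSeq_two_sub _ elem_zero]; exact EPositive.elem 2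
  | succ a =>
    have h : Dumbbell.pathSeq Dumbbell.elem (a + 1 + 2) -
        Dumbbell.elem 2 * Dumbbell.pathSeq Dumbbell.elem (a + 1) = Dumbbell.elem (a + 3) +
          ∑ p ∈ antidiagonal a, Dumbbell.pathSeq Dumbbell.elem p.1 *
            ((p.2 + 2 : ℕ) * Dumbbell.elem (p.2 + 3)) := by
      rw [pathSeq_succ, Finset.Nat.antidiagonal_succ', sum_cons, sum_map,
        Finset.Nat.antidiagonal_succ', sum_cons, sum_map]
      simp [add_assoc]
      ring
    rw [h]
    exact (EPositive.elem _).add (EPositive.sum fun p _ =>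
      (EPositive.pathSeq _).mul ((EPositive.natCast _).mul (EPositive.elem _)))

/-- Prefixes are matched by lengthening them by two, as in `pathSeq_sub`. The only negative
leftover, `-e_2 e_{k+i+2}`, is absorbed by the term of the empty prefix, `(k + i + 1) e_2
e_{k+i+2}`; that term is therefore split off the sum. -/
theorem EPositive.crossSeq_sub (i k : ℕ) :
    EPositive (crossSeq Dumbbell.elem (i + 1) (k + 2) -
      Dumbbell.elem 2 * crossSeq Dumbbell.elem (i + 1) k) := by
  set e := Dumbbell.elem with he
  have hmem : (0, k) ∈ antidiagonal k := by simp
  have h : crossSeq e (i + 1) (k + 2) - e 2 * crossSeq e (i + 1) k =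
      e (k + i + 4) + (k + i + 3 : ℕ) * e (k + i + 4) +
      Dumbbell.pathSeq e 1 * ((k + i + 2 : ℕ) * e (k + i + 3)) + (k + i : ℕ) * (e 2 * e (k + i + 2))
      + ∑ p ∈ (antidiagonal k).erase (0, k), (Dumbbell.pathSeq e (p.1 + 1 + 1) -
        e 2 * Dumbbell.pathSeq e p.1) * ((p.2 + (i + 1) : ℕ) * e (p.2 + 1 + (i + 1))) := by
    have h1 : ∑ p ∈ antidiagonal k, (Dumbbell.pathSeq e (p.1 + 1 + 1) -
        e 2 * Dumbbell.pathSeq e p.1) * ((p.2 + (i + 1) : ℕ) * e (p.2 + 1 + (i + 1))) =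
        ∑ p ∈ antidiagonal k,
          Dumbbell.pathSeq e (p.1 + 1 + 1) * ((p.2 + (i + 1) : ℕ) * e (p.2 + 1 + (i + 1))) -
        e 2 * ∑ p ∈ antidiagonal k,
          Dumbbell.pathSeq e p.1 * ((p.2 + (i + 1) : ℕ) * e (p.2 + 1 + (i + 1))) := by
      rw [mul_sum, ← sum_sub_distrib]
      exact sum_congr rfl fun p _ => by ring
    rw [← add_sum_erase _ _ hmem] at h1
    simp only [zero_add, pathSeq_two_sub e elem_zero] at h1
    have h0 : Dumbbell.pathSeq e 0 = 1 := pathSeq_zero e elem_zero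
    rw [crossSeq, crossSeq, Finset.Nat.antidiagonal_succ, sum_cons, sum_map,
      Finset.Nat.antidiagonal_succ, sum_cons, sum_map]
    simp only [Function.Embedding.prodMap, Function.Embedding.coeFn_mk,
      Function.Embedding.refl_apply, Prod.map, Nat.succ_eq_add_one, h0, zero_add,
      show k + 2 + 1 + (i + 1) = k + i + 4 by omega, show k + 1 + 1 + (i + 1) = k + i + 3 by omega,
      show k + 1 + (i + 1) = k + i + 2 by omega] at h1 ⊢
    push_cast at h1 ⊢
    linear_combination -h1
  rw [h]
  exact ((((EPositive.elem _).add ((EPositive.natCast _).mul (EPositive.elem _))).add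
    ((EPositive.pathSeq _).mul ((EPositive.natCast _).mul (EPositive.elem _)))).add
    ((EPositive.natCast _).mul ((EPositive.elem _).mul (EPositive.elem _)))).add
    (EPositive.sum fun p _ =>
      (EPositive.pathSeq_sub _).mul ((EPositive.natCast _).mul (EPositive.elem _)))

theorem EPositive.tadpoleSeq_sub (r k : ℕ) :
    EPositive (tadpoleSeq Dumbbell.elem r (k + 2) -
      Dumbbell.elem 2 * tadpoleSeq Dumbbell.elem r k) := by
  rw [tadpoleSeq, tadpoleSeq, mul_sum, ← sum_sub_distrib]
  refine EPositive.sum fun p _ => ?_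
  rw [mul_left_comm, ← mul_sub]
  rcases p with ⟨i, j⟩
  cases i with
  -- The weight `p.1` vanishes here, so `crossSeq_sub` is needed only for positive index.
  | zero => simpa using EPositive.zero
  | succ i =>
    exact ((EPositive.natCast _).mul (EPositive.wordSeq _)).mul (EPositive.crossSeq_sub i k)

end Positivity

/-! ### Reduction from infinitely many variables to `q` colours -/

section Truncation

/-- The power series without monomials in the variables with index less than `q`. -/
def truncIdeal (q : ℕ) : Ideal (MvPowerSeries ℕ ℚ) where
  carrier := {f | ∀ d : ℕ →₀ ℕ, d.support ⊆ range q → MvPowerSeries.coeff d f = 0}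
  zero_mem' := fun d _ => by simp
  add_mem' := fun hf hg d hd => by rw [map_add, hf d hd, hg d hd, add_zero]
  smul_mem' := fun c f hf d hd => by
    rw [smul_eq_mul, MvPowerSeries.coeff_mul]
    refine sum_eq_zero fun p hp => ?_
    rw [hf p.2, mul_zero]
    refine subset_trans (Finsupp.support_mono ?_) hd
    rw [← mem_antidiagonal.1 hp]
    exact le_add_self

theorem eq_of_forall_mk_eq {f g : MvPowerSeries ℕ ℚ}
    (h : ∀ q, Ideal.Quotient.mk (truncIdeal q) f = Ideal.Quotient.mk (truncIdeal q) g) :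
    f = g := by
  ext d
  obtain ⟨q, hq⟩ := d.support.exists_nat_subset_range
  have := Ideal.Quotient.eq.1 (h q) d hq
  rwa [map_sub, sub_eq_zero] at this

theorem monomial_sum_single {κ : Type*} (s : Finset κ) (f : κ → ℕ) :
    MvPowerSeries.monomial (∑ i ∈ s, Finsupp.single (f i) 1) (1 : ℚ) =
      ∏ i ∈ s, MvPowerSeries.X (f i) := by
  classical
  induction s using Finset.induction_on with
  | empty => simp
  | insert i s hi ih =>
    rw [sum_insert hi, prod_insert hi, ← ih, MvPowerSeries.X, MvPowerSeries.monomial_mul_monomial,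
      one_mul]

theorem support_sum_single {κ : Type*} (s : Finset κ) (f : κ → ℕ) (t : Finset ℕ) :
    (∑ i ∈ s, Finsupp.single (f i) 1).support ⊆ t ↔ ∀ i ∈ s, f i ∈ t := by
  constructor
  · intro h i hi
    refine h ?_
    rw [Finsupp.mem_support_iff, Finsupp.finsetSum_apply]
    intro h0
    have := sum_eq_zero_iff.1 h0 i hi
    simp at this
  · intro h j hj
    rw [Finsupp.mem_support_iff, Finsupp.finsetSum_apply] at hj
    obtain ⟨i, hi, hij⟩ := exists_ne_zero_of_sum_ne_zero hj
    rw [Finsupp.single_apply] at hij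
    have : f i = j := by
      by_contra hne
      exact hij (if_neg hne)
    exact this ▸ h i hi

/-- Only indices whose monomial lies in the first `q` variables survive; `φ` enumerates them by a
finite type, so the formal sum becomes a genuine one. -/
theorem mk_monomialSum {κ κ' : Type*} [Fintype κ'] (a : κ → (ℕ →₀ ℕ)) (q : ℕ) (φ : κ' → κ)
    (hφ : Function.Injective φ) (h : ∀ i, (a i).support ⊆ range q ↔ i ∈ Set.range φ) :
    Ideal.Quotient.mk (truncIdeal q) (monomialSum a) =
      Ideal.Quotient.mk (truncIdeal q) (∑ j, MvPowerSeries.monomial (a (φ j)) 1) := by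
  classical
  rw [Ideal.Quotient.eq]
  intro d hd
  have h1 : MvPowerSeries.coeff d (monomialSum a) = (Nat.card {i : κ // a i = d} : ℚ) := rfl
  have h2 : Nat.card {j : κ' // a (φ j) = d} = Nat.card {i : κ // a i = d} := by
    refine Nat.card_congr (Equiv.ofBijective (fun j => ⟨φ j.1, j.2⟩) ⟨fun j j' hj => ?_, ?_⟩)
    · exact Subtype.ext (hφ (congrArg Subtype.val hj))
    · rintro ⟨i, hi⟩
      obtain ⟨j, rfl⟩ := (h i).1 (hi ▸ hd)
      exact ⟨⟨j, hi⟩, rfl⟩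
  rw [map_sub, map_sum, h1, ← h2, Nat.card_eq_fintype_card, Fintype.card_subtype]
  simp [MvPowerSeries.coeff_monomial, eq_comm]

end Truncation

/-- The images of the variables in the truncation. -/
noncomputable def truncX (q : ℕ) (i : Fin q) : MvPowerSeries ℕ ℚ ⧸ truncIdeal q :=
  Ideal.Quotient.mk (truncIdeal q) (MvPowerSeries.X (i : ℕ))

theorem mk_elem (q j : ℕ) :
    Ideal.Quotient.mk (truncIdeal q) (elem j) = elemSum (truncX q) j := by
  have hinj := fun s : Finset (Fin q) => Finset.card_map (s := s) Fin.valEmbedding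
  rw [elem, mk_monomialSum (κ' := {s // s ∈ powersetCard j (univ : Finset (Fin q))}) _ q
    (fun s => ⟨s.1.map Fin.valEmbedding, by rw [hinj, (mem_powersetCard.1 s.2).2]⟩)]
  · rw [elemSum, ← sum_coe_sort (powersetCard j univ), map_sum]
    refine sum_congr rfl fun s _ => ?_
    rw [setExponent, monomial_sum_single _ fun j => j, prod_map, map_prod]
    rfl
  · intro s t h
    exact Subtype.ext (Finset.map_injective _ (congrArg Subtype.val h))
  · rintro ⟨s, hs⟩
    rw [setExponent, support_sum_single]
    constructor
    · intro h
      have hm : (filter (fun i : Fin q => (i : ℕ) ∈ s) univ).map Fin.valEmbedding = s := by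
        ext i
        simp only [mem_map, mem_filter, mem_univ, true_and, Fin.valEmbedding_apply]
        exact ⟨fun ⟨a, ha, hai⟩ => hai ▸ ha, fun hi => ⟨⟨i, mem_range.1 (h i hi)⟩, hi, rfl⟩⟩
      refine ⟨⟨_, mem_powersetCard.2 ⟨subset_univ _, ?_⟩⟩, Subtype.ext hm⟩
      exact (hinj _).symm.trans ((congrArg Finset.card hm).trans hs)
    · rintro ⟨t, ht⟩ i hi
      have : t.1.map Fin.valEmbedding = s := congrArg Subtype.val ht
      obtain ⟨a, -, rfl⟩ := mem_map.1 (this ▸ hi : i ∈ t.1.map Fin.valEmbedding)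
      exact mem_range.2 a.2

open Classical in
theorem mk_chromaticSymm {V : Type*} [Fintype V] [DecidableEq V] (G : SimpleGraph V) (q : ℕ) :
    Ideal.Quotient.mk (truncIdeal q) (chromaticSymm G) =
      ∑ w : V → Fin q, if ∀ a b, G.Adj a b → w a ≠ w b then ∏ v, truncX q (w v) else 0 := by
  rw [chromaticSymm, mk_monomialSum
    (κ' := {w : V → Fin q // ∀ a b, G.Adj a b → w a ≠ w b}) _ q
    (fun w => SimpleGraph.Coloring.mk (fun v => (w.1 v : ℕ))
      fun {a b} h h' => w.2 a b h (Fin.ext h'))]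
  · rw [← sum_filter, map_sum, sum_subtype (p := fun w : V → Fin q => ∀ a b, G.Adj a b → w a ≠ w b) _
      (fun w => by simp)]
    refine sum_congr rfl fun w _ => ?_
    rw [colouringExponent, monomial_sum_single, map_prod]
    rfl
  · intro w w' h
    refine Subtype.ext (funext fun v => Fin.ext ?_)
    exact congrArg (fun k : G.Coloring ℕ => k v) h
  · intro k
    rw [colouringExponent, support_sum_single]
    constructor
    · intro h
      refine ⟨⟨fun v => ⟨k v, mem_range.1 (h v (mem_univ v))⟩, fun a b hab h' => ?_⟩, ?_⟩
      · exact k.valid hab (congrArg Fin.val h')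
      · exact DFunLike.ext _ _ fun v => rfl
    · rintro ⟨w, rfl⟩ v -
      exact mem_range.2 (w.1 v).2

/-! ### From graph colourings to words, and the theorem -/

theorem isDumbbellWord_iff {α : Type*} (r k : ℕ) (hr : 2 ≤ r)
    (h : 2 + k + r + 1 = (((r + 1 : ℕ) : ℤ) + ((k : ℤ) - 1) + ((3 : ℕ) : ℤ)).toNat)
    (w : Fin (((r + 1 : ℕ) : ℤ) + ((k : ℤ) - 1) + ((3 : ℕ) : ℤ)).toNat → α) :
    (∀ a b, (dumbbell (r + 1) (k - 1) 3).Adj a b → w a ≠ w b) ↔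
      IsDumbbellWord r k (w ∘ Fin.cast h) := by
  constructor
  · intro H
    refine ⟨fun i => H _ _ ?_, (H _ _ ?_).symm, H _ _ ?_⟩
    · refine ⟨?_, Or.inl (Or.inl ?_)⟩
      · simp [Fin.ext_iff]
      · simp
    · refine ⟨?_, Or.inl (Or.inr (Or.inl ⟨?_, ?_⟩))⟩
      · simp [Fin.ext_iff]; omega
      · simp
      · simp
    · refine ⟨?_, Or.inl (Or.inr (Or.inr ⟨?_, ?_⟩))⟩
      · simp [Fin.ext_iff]
      · simp; omega
      · simp; omega
  · rintro ⟨h1, h2, h3⟩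
    have key : ∀ a b : Fin (((r + 1 : ℕ) : ℤ) + ((k : ℤ) - 1) + ((3 : ℕ) : ℤ)).toNat,
        ((b : ℤ) = a + 1 ∨ ((a : ℤ) = 0 ∧ (b : ℤ) = (r + 1 : ℕ) - 1) ∨
          ((a : ℤ) = (r + 1 : ℕ) + ((k : ℤ) - 1) ∧
            (b : ℤ) = (r + 1 : ℕ) + ((k : ℤ) - 1) + (3 : ℕ) - 1)) → w a ≠ w b := by
      rintro ⟨a, ha⟩ ⟨b, hb⟩ (h' | ⟨ha', hb'⟩ | ⟨ha', hb'⟩)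
      · have hb2 : b = a + 1 := by simp at h'; omega
        subst hb2
        exact h1 ⟨a, by omega⟩
      · have ha2 : a = 0 := by simpa using ha'
        have hb2 : b = r := by simp at hb'; omega
        subst ha2 hb2
        exact h2.symm
      · have ha2 : a = k + r := by simp at ha'; omega
        have hb2 : b = k + 2 + r := by simp at hb'; omega
        subst ha2 hb2
        exact h3
    rintro a b ⟨-, hab | hab⟩
    · exact key a b hab
    · exact (key b a hab).symm

theorem chromaticSymm_dumbbell (r k : ℕ) (hr : 2 ≤ r) :
    chromaticSymm (dumbbell (r + 1) (k - 1) 3) =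
      2 * (tadpoleSeq elem r (k + 2) - elem 2 * tadpoleSeq elem r k) := by
  refine eq_of_forall_mk_eq fun q => ?_
  have h : 2 + k + r + 1 = (((r + 1 : ℕ) : ℤ) + ((k : ℤ) - 1) + ((3 : ℕ) : ℤ)).toNat := by omega
  simp only [map_mul, map_sub, map_tadpoleSeq, mk_elem, map_ofNat]
  rw [← sum_isDumbbellWord, mk_chromaticSymm]
  refine Fintype.sum_equiv ((finCongr h).symm.arrowCongr (Equiv.refl _)) _ _ fun w => ?_
  have hw : ((finCongr h).symm.arrowCongr (Equiv.refl _)) w = w ∘ Fin.cast h := rfl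
  rw [hw]
  have hi := isDumbbellWord_iff r k hr h w
  by_cases hg : IsDumbbellWord r k (w ∘ Fin.cast h)
  · rw [if_pos hg, if_pos (hi.2 hg)]
    exact ((finCongr h).prod_comp fun v => truncX q (w v)).symm
  · rw [if_neg hg, if_neg (mt hi.1 hg)]

end Dumbbell

theorem mainTheorem9 (m : ℕ) (hm : 3 ≤ m) (l : ℤ) (hl : -1 ≤ l) :
    Dumbbell.EPositive (Dumbbell.chromaticSymm (Dumbbell.dumbbell m l 3)) := by
  obtain ⟨r, rfl⟩ : ∃ r, m = r + 1 := ⟨m - 1, by omega⟩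
  -- The tail counts the apex of the triangle besides the `l` path vertices; for `l = -1` it is
  -- empty and the apex lies on the cycle.
  obtain ⟨k, rfl⟩ : ∃ k : ℕ, l = k - 1 := ⟨(l + 1).toNat, by omega⟩
  rw [Dumbbell.chromaticSymm_dumbbell r k (by omega)]
  exact (Dumbbell.EPositive.natCast 2).mul (Dumbbell.EPositive.tadpoleSeq_sub r k)
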